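/- For all positive integers $m,n,r,s$ and every integer $a\ge 0$, the number $$d=\frac{(2m)!\,(2n)!}{2\,(m+n)!\,(m-1)!\,(n-1)!\,\gcd(m,n)}$$ is an integer, and the sum $$\sum_{k=1}^m k^{2a+1}\binom{2m}{m+k}^r\binom{2n}{n+k}^s$$ is divisible by $d$ (where $\binom{2n}{n+k}=0$ for $k>n$). -/

import Mathlib

open scoped Nat

/-! Up to the factor (2m)!(2n)!/(m+n)!², replacing one C(2m,m+k)C(2n,n+k) by C(m+n,m+k)C(m+n,n+k)
turns the summand into k^(2a+1) times a product around a cycle of m's and n's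
(`choose_mul_choose_mul_factorial_sq`). Vandermonde removes one vertex of the cycle at a time, with
coefficients free of k, until only sums of k^(2a+1)C(2l,l+k) remain
(`dvd_two_mul_sum_pow_mul_choose`). Twice the cyclic sum is thus divisible by yC(x+y,y) for adjacent
vertices x, y (`dvd_two_mul_sum_cycleProd`). Cutting at m and at n gives lcm(m,n)C(m+n,m); the
evenness of the super Catalan number absorbs the 2. -/

/-- The product `C(x+z₁, x+k) C(z₁+z₂, z₁+k) ⋯ C(z_t+y, z_t+k)` along the path `x, z₁, …, z_t, y`. -/
def pathProd (k : ℕ) : ℕ → List ℕ → ℕ → ℕ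
  | x, [], y => (x + y).choose (x + k)
  | x, z :: L, y => (x + z).choose (x + k) * pathProd k z L y

/-- The product of `pathProd` and the binomial coefficient that closes the cycle. -/
def cycleProd (k x : ℕ) (L : List ℕ) (y : ℕ) : ℕ :=
  pathProd k x L y * (y + x).choose (y + k)

/-! ### One-binomial sums -/

theorem two_mul_sum_mul_choose (x K : ℕ) :
    2 * ∑ k ∈ Finset.range K, k * (2 * x).choose (x + k) + (x + K) * (2 * x).choose (x + K)
      = x * (2 * x).choose x := by
  induction K with
  | zero => simp
  | succ K ih =>
    rw [Finset.sum_range_succ, ← ih]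
    rcases le_or_gt K x with h | h
    · have h1 := Nat.choose_succ_right_eq (2 * x) (x + K)
      obtain ⟨t, rfl⟩ := Nat.exists_eq_add_of_le h
      rw [show 2 * (K + t) - (K + t + K) = t by omega] at h1
      rw [show K + t + (K + 1) = K + t + K + 1 by ring]
      linarith
    · rw [Nat.choose_eq_zero_of_lt (show 2 * x < x + K by omega),
        Nat.choose_eq_zero_of_lt (show 2 * x < x + (K + 1) by omega)]
      simp

theorem choose_two_mul_succ_mul (x k : ℕ) :
    (((x + 1 : ℕ) : ℤ) ^ 2 - (k : ℤ) ^ 2) * (2 * (x + 1)).choose (x + 1 + k)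
      = 2 * (x + 1) * (2 * x + 1) * (2 * x).choose (x + k) := by
  rcases le_or_gt k x with h | h
  · obtain ⟨t, rfl⟩ := Nat.exists_eq_add_of_le h
    have h1 := Nat.add_one_mul_choose_eq (2 * (k + t) + 1) (k + t + k)
    have h2 := Nat.choose_mul_succ_eq (2 * (k + t)) (k + t + k)
    rw [show 2 * (k + t) + 1 - (k + t + k) = t + 1 by omega] at h2
    rw [show 2 * (k + t + 1) = 2 * (k + t) + 1 + 1 by ring,
      show k + t + 1 + k = k + t + k + 1 by ring]
    zify at h1 h2
    push_cast
    linear_combination (-(t + 1 : ℤ)) * h1 - (2 * (k + t) + 2 : ℤ) * h2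
  · rw [Nat.choose_eq_zero_of_lt (show 2 * x < x + k by omega)]
    rcases Nat.lt_or_ge (x + 1) k with h' | h'
    · rw [Nat.choose_eq_zero_of_lt (show 2 * (x + 1) < x + 1 + k by omega)]
      simp
    · obtain rfl : k = x + 1 := by omega
      simp

theorem dvd_two_mul_sum_pow_mul_choose (a x K : ℕ) (h : x < K) :
    ((x * (2 * x).choose x : ℕ) : ℤ) ∣
      2 * ∑ k ∈ Finset.range K, (k : ℤ) ^ (2 * a + 1) * (2 * x).choose (x + k) := by
  induction a generalizing x with
  | zero =>
    have h1 := two_mul_sum_mul_choose x K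
    rw [Nat.choose_eq_zero_of_lt (show 2 * x < x + K by omega)] at h1
    rw [← h1]
    simp
  | succ a ih =>
    cases x with
    | zero =>
      have : ∀ k ∈ Finset.range K,
          (k : ℤ) ^ (2 * (a + 1) + 1) * (2 * 0).choose (0 + k) = 0 := by
        intro k _
        cases k <;> simp
      rw [Finset.sum_eq_zero this]
      simp
    | succ x =>
      -- Write k² = (x+1)² - ((x+1)² - k²); the second part lowers x + 1 to x.
      have key : (2 * ∑ k ∈ Finset.range K,
            (k : ℤ) ^ (2 * (a + 1) + 1) * (2 * (x + 1)).choose (x + 1 + k))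
          = ((x + 1 : ℕ) : ℤ) ^ 2 * (2 * ∑ k ∈ Finset.range K,
              (k : ℤ) ^ (2 * a + 1) * (2 * (x + 1)).choose (x + 1 + k))
            - 2 * (x + 1) * (2 * x + 1) * (2 * ∑ k ∈ Finset.range K,
              (k : ℤ) ^ (2 * a + 1) * (2 * x).choose (x + k)) := by
        simp only [Finset.mul_sum, ← Finset.sum_sub_distrib]
        refine Finset.sum_congr rfl fun k _ => ?_
        linear_combination (-2 * (k : ℤ) ^ (2 * a + 1)) * choose_two_mul_succ_mul x k
      rw [key]
      refine dvd_sub (Dvd.dvd.mul_left (ih (x + 1) h) _) ?_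
      obtain ⟨t, ht⟩ := ih x (by omega)
      rw [ht]
      have h0 := choose_two_mul_succ_mul x 0
      simp only [add_zero] at h0
      have h1 : ((x + 1 : ℕ) : ℤ) * (2 * (x + 1)).choose (x + 1)
          = 2 * (2 * x + 1) * (2 * x).choose x := by
        have : ((x + 1 : ℕ) : ℤ) ≠ 0 := by positivity
        apply mul_left_cancel₀ this
        push_cast at h0 ⊢
        linear_combination h0
      refine ⟨(x + 1) * x * t, ?_⟩
      push_cast at h1 ⊢
      linear_combination (-(x + 1) * x * t : ℤ) * h1

/-! ### Shortening a cycle -/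

/-- Both sides are the multinomial (z+w)!/((z-l)!(w-k)!(l+k)!). -/
theorem choose_mul_choose_merge_right (z w k l : ℕ) :
    (z + w).choose (z + k) * (z + k).choose (l + k)
      = (z + w).choose (w + l) * (w + l).choose (l + k) := by
  rcases Nat.lt_or_ge z l with h | h
  · rw [Nat.choose_eq_zero_of_lt (show z + k < l + k by omega),
      Nat.choose_eq_zero_of_lt (show z + w < w + l by omega)]
    simp
  rcases Nat.lt_or_ge w k with h' | h'
  · rw [Nat.choose_eq_zero_of_lt (show z + w < z + k by omega),
      Nat.choose_eq_zero_of_lt (show w + l < l + k by omega)]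
    simp
  rw [Nat.choose_mul (by omega), Nat.choose_mul (by omega)]
  congr 1
  exact Nat.choose_symm_of_eq_add (by omega)

theorem choose_mul_choose_merge_left (x y k l : ℕ) (hk : k ≤ l) (hl : l ≤ x) :
    (y + x).choose (y + k) * (x - k).choose (l - k)
      = (y + x).choose (y + l) * (y + l).choose (y + k) := by
  rw [Nat.choose_mul (by omega)]
  congr 2 <;> omega

theorem choose_add_eq_sum_Icc (x z k : ℕ) (h : k ≤ x) :
    (x + z).choose (x + k)
      = ∑ l ∈ Finset.Icc k x, (x - k).choose (l - k) * (z + k).choose (l + k) := by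
  rw [show x + z = (x - k) + (z + k) by omega, Nat.add_choose_eq,
    Finset.Nat.sum_antidiagonal_eq_sum_range_succ
      (fun i j => (x - k).choose i * (z + k).choose j)]
  symm
  refine Finset.sum_bij_ne_zero (fun l _ _ => x - l) ?_ ?_ ?_ ?_
  · intro l _ _
    simp only [Finset.mem_range]
    omega
  · intro l hl _ l' hl' _ he
    simp only [Finset.mem_Icc] at hl hl'
    omega
  · intro i hi hne
    have h1 : i ≤ x - k := by
      by_contra hc
      rw [Nat.choose_eq_zero_of_lt (by omega)] at hne
      simp at hne
    have e : x + k - i = x - i + k := by omega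
    have e' : (x - k).choose (x - i - k) = (x - k).choose i :=
      Nat.choose_symm_of_eq_add (by omega)
    refine ⟨x - i, ?_, ?_, ?_⟩
    · simp only [Finset.mem_Icc]
      omega
    · rw [e', ← e]
      exact hne
    · omega
  · intro l hl _
    simp only [Finset.mem_Icc] at hl
    congr 1
    · exact Nat.choose_symm_of_eq_add (by omega)
    · congr 1
      omega

theorem choose_mul_choose_eq_sum (x y z k : ℕ) :
    (x + z).choose (x + k) * (y + x).choose (y + k)
      = ∑ l ∈ Finset.range (x + 1),
        (y + x).choose (y + l) * ((y + l).choose (y + k) * (z + k).choose (l + k)) := by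
  rcases Nat.lt_or_ge x k with h | h
  · rw [Nat.choose_eq_zero_of_lt (show y + x < y + k by omega), mul_zero, eq_comm]
    refine Finset.sum_eq_zero fun l hl => ?_
    rw [Finset.mem_range] at hl
    rw [Nat.choose_eq_zero_of_lt (show y + l < y + k by omega)]
    simp
  · rw [choose_add_eq_sum_Icc x z k h, Finset.sum_mul]
    refine Finset.sum_subset_zero_on_sdiff ?_ ?_ ?_
    · intro l hl
      simp only [Finset.mem_Icc, Finset.mem_range] at hl ⊢
      omega
    · intro l hl
      simp only [Finset.mem_sdiff, Finset.mem_Icc, Finset.mem_range] at hl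
      rw [Nat.choose_eq_zero_of_lt (show y + l < y + k by omega)]
      simp
    · intro l hl
      rw [Finset.mem_Icc] at hl
      have := choose_mul_choose_merge_left x y k l hl.1 hl.2
      rw [← mul_assoc, ← this]
      ring

theorem cycleProd_nil_eq_sum (k x y : ℕ) :
    cycleProd k x [] y = ∑ l ∈ Finset.range (x + 1),
      (y + x).choose (y + l) * (y + l).choose (2 * l) * (2 * l).choose (l + k) := by
  rw [cycleProd, pathProd, choose_mul_choose_eq_sum]
  refine Finset.sum_congr rfl fun l _ => ?_
  rw [choose_mul_choose_merge_right y l k l, ← two_mul, mul_assoc]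

/-- The extra binomial moves the start of the path from z to l at a cost independent of k, so `c`
can leave the sum over k. -/
theorem pathProd_mul_choose (l z y : ℕ) (L : List ℕ) :
    ∃ c, ∀ k, pathProd k z L y * (z + k).choose (l + k) = c * pathProd k l L y := by
  cases L with
  | nil =>
    refine ⟨(z + y).choose (y + l), fun k => ?_⟩
    rw [pathProd, pathProd, choose_mul_choose_merge_right, add_comm l y]
  | cons w L =>
    refine ⟨(z + w).choose (w + l), fun k => ?_⟩
    have := choose_mul_choose_merge_right z w k l
    rw [pathProd, pathProd, add_comm l w]
    linear_combination pathProd k w L y * this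

theorem exists_cycleProd_cons_eq_sum (x z y : ℕ) (L : List ℕ) :
    ∃ c : ℕ → ℕ, ∀ k, cycleProd k x (z :: L) y = ∑ l ∈ Finset.range (x + 1),
      (y + x).choose (y + l) * c l * cycleProd k l L y := by
  choose c hc using fun l => pathProd_mul_choose l z y L
  refine ⟨c, fun k => ?_⟩
  rw [cycleProd, pathProd, mul_right_comm, choose_mul_choose_eq_sum, Finset.sum_mul]
  refine Finset.sum_congr rfl fun l _ => ?_
  rw [cycleProd]
  linear_combination (y + x).choose (y + l) * (y + l).choose (y + k) * hc l k

/-! ### Divisibility of cyclic sums -/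

theorem dvd_two_mul_sum_of_eq_sum {a K x : ℕ} {D : ℕ} (f : ℕ → ℕ) (c : ℕ → ℕ) (g : ℕ → ℕ → ℕ)
    (hf : ∀ k, f k = ∑ l ∈ Finset.range (x + 1), c l * g l k)
    (h : ∀ l ≤ x, D ∣ c l * (2 * ∑ k ∈ Finset.range K, k ^ (2 * a + 1) * g l k)) :
    D ∣ 2 * ∑ k ∈ Finset.range K, k ^ (2 * a + 1) * f k := by
  have : 2 * ∑ k ∈ Finset.range K, k ^ (2 * a + 1) * f k
      = ∑ l ∈ Finset.range (x + 1),
        c l * (2 * ∑ k ∈ Finset.range K, k ^ (2 * a + 1) * g l k) := by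
    simp only [hf, Finset.mul_sum]
    rw [Finset.sum_comm]
    refine Finset.sum_congr rfl fun l _ => Finset.sum_congr rfl fun k _ => ?_
    ring
  rw [this]
  refine Finset.dvd_sum fun l hl => h l ?_
  rw [Finset.mem_range] at hl
  omega

theorem mul_choose_dvd_mul_choose (x y l : ℕ) (hl : l ≤ x) :
    y * (y + x).choose y ∣
      (y + x).choose (y + l) * (y + l).choose (2 * l) * (l * (2 * l).choose l) := by
  rcases Nat.lt_or_ge y l with h | h
  · rw [Nat.choose_eq_zero_of_lt (show y + l < 2 * l by omega)]
    simp
  rcases l with _ | l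
  · simp
  obtain ⟨y, rfl⟩ : ∃ t, y = t + 1 := ⟨y - 1, by omega⟩
  have h1 := Nat.choose_mul (n := y + 1 + (l + 1)) (k := 2 * (l + 1)) (s := l + 1)
    (by omega)
  rw [show y + 1 + (l + 1) - (l + 1) = y + 1 by omega,
    show 2 * (l + 1) - (l + 1) = l + 1 by omega] at h1
  have h2 := Nat.choose_mul (n := y + 1 + x) (k := y + 1 + (l + 1)) (s := y + 1)
    (by omega)
  have h3 := Nat.add_one_mul_choose_eq y l
  -- In the original variables the quotient is C(x,l)C(y-1,l-1), from lC(y,l) = yC(y-1,l-1).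
  refine ⟨x.choose (l + 1) * y.choose l, ?_⟩
  rw [show y + 1 + x - (y + 1) = x by omega,
    show y + 1 + (l + 1) - (y + 1) = l + 1 by omega] at h2
  have h1' : (y + 1 + (l + 1)).choose (y + 1) = (y + 1 + (l + 1)).choose (l + 1) :=
    Nat.choose_symm_add
  zify at h1 h2 h3 h1' ⊢
  grind

theorem dvd_two_mul_sum_cycleProd (a K y : ℕ) (L : List ℕ) (x : ℕ) (hx : x < K) :
    y * (y + x).choose y ∣
      2 * ∑ k ∈ Finset.range K, k ^ (2 * a + 1) * cycleProd k x L y := by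
  induction L generalizing x with
  | nil =>
    refine dvd_two_mul_sum_of_eq_sum _ _ _ (fun k => cycleProd_nil_eq_sum k x y) fun l hl => ?_
    refine (mul_choose_dvd_mul_choose x y l hl).trans (Nat.mul_dvd_mul_left _ ?_)
    exact_mod_cast dvd_two_mul_sum_pow_mul_choose a l K (by omega)
  | cons z L ih =>
    obtain ⟨c, hc⟩ := exists_cycleProd_cons_eq_sum x z y L
    refine dvd_two_mul_sum_of_eq_sum _ _ _ hc fun l hl => ?_
    obtain ⟨t, ht⟩ := ih l (by omega)
    rw [ht]
    have h2 := Nat.choose_mul (n := y + x) (k := y + l) (s := y) (by omega)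
    rw [show y + x - y = x by omega, show y + l - y = l by omega] at h2
    refine ⟨x.choose l * c l * t, ?_⟩
    linear_combination y * c l * t * h2

theorem pathProd_replicate_append (k x y : ℕ) (p q : ℕ) :
    pathProd k x (List.replicate p x ++ List.replicate q y) y
      = (2 * x).choose (x + k) ^ p * (2 * y).choose (y + k) ^ q * (x + y).choose (x + k) := by
  induction p with
  | zero =>
    have h : ∀ q, pathProd k y (List.replicate q y) y = (2 * y).choose (y + k) ^ (q + 1) := by
      intro q
      induction q with
      | zero => simp [pathProd, two_mul]
      | succ q ih => rw [List.replicate_succ, pathProd, ih, ← two_mul, pow_succ' _ (q + 1)]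
    cases q with
    | zero => simp [pathProd]
    | succ q =>
      rw [List.replicate_zero, List.nil_append, List.replicate_succ, pathProd, h]
      ring
  | succ p ih =>
    rw [List.replicate_succ, List.cons_append, pathProd, ih, ← two_mul]
    ring

theorem lcm_mul_choose_dvd_two_mul_sum (a m n p q K : ℕ) (hm : m < K) (hn : n < K) :
    Nat.lcm m n * (m + n).choose m ∣ 2 * ∑ k ∈ Finset.range K, k ^ (2 * a + 1) *
      ((2 * m).choose (m + k) ^ p * (2 * n).choose (n + k) ^ q *
        ((m + n).choose (m + k) * (m + n).choose (n + k))) := by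
  rw [← Nat.lcm_mul_right]
  refine Nat.lcm_dvd ?_ ?_
  · have h := dvd_two_mul_sum_cycleProd a K m (List.replicate q n ++ List.replicate p m) n hn
    refine h.trans (dvd_of_eq ?_)
    congr 1
    refine Finset.sum_congr rfl fun k _ => ?_
    rw [cycleProd, pathProd_replicate_append, add_comm n m]
    ring
  · have h := dvd_two_mul_sum_cycleProd a K n (List.replicate p m ++ List.replicate q n) m hm
    rw [Nat.choose_symm_add, add_comm m n]
    refine h.trans (dvd_of_eq ?_)
    congr 1
    refine Finset.sum_congr rfl fun k _ => ?_
    rw [cycleProd, pathProd_replicate_append, add_comm n m]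
    ring

/-! ### Back to the original sum -/

/-- The super Catalan numbers `(2m)! (2n)! / ((m+n)! m! n!)` are even integers for `n > 0`. -/
theorem exists_two_mul_eq_superCatalan (m n : ℕ) (hn : 0 < n) :
    ∃ B : ℕ, 2 * B * ((m + n)! * m ! * n !) = (2 * m)! * (2 * n)! := by
  suffices h : ∀ n, 0 < n →
      ∃ B : ℤ, 2 * B * ((m + n)! * m ! * n !) = (2 * m)! * (2 * n)! by
    obtain ⟨B, hB⟩ := h n hn
    have hpos : 0 ≤ B := by
      by_contra hc
      have h1 : 2 * B * ((m + n)! * m ! * n !) < 0 :=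
        mul_neg_of_neg_of_pos (by omega) (by positivity)
      have h2 : (0 : ℤ) < (2 * m)! * (2 * n)! := by positivity
      omega
    lift B to ℕ using hpos
    exact ⟨B, by exact_mod_cast hB⟩
  induction m with
  | zero =>
    intro n hn
    obtain ⟨c, hc⟩ := Nat.two_dvd_centralBinom_of_one_le hn
    refine ⟨c, ?_⟩
    have h1 := Nat.choose_mul_factorial_mul_factorial (show n ≤ 2 * n by omega)
    rw [← Nat.centralBinom_eq_two_mul_choose, hc, show 2 * n - n = n by omega] at h1
    zify at h1
    simp only [Nat.factorial_zero, Nat.zero_add, Nat.mul_zero]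
    push_cast
    linear_combination h1
  | succ m ih =>
    intro n hn
    obtain ⟨B, hB⟩ := ih n hn
    obtain ⟨C, hC⟩ := ih (n + 1) (by omega)
    -- The recurrence S(m+1,n) = 4S(m,n) - S(m,n+1); its subtraction is why `B` is taken in ℤ.
    refine ⟨4 * B - C, ?_⟩
    have hne : ((n : ℤ) + 1) ≠ 0 := by positivity
    apply mul_left_cancel₀ hne
    rw [show m + (n + 1) = m + n + 1 by ring, show 2 * (n + 1) = 2 * n + 1 + 1 by ring] at hC
    rw [show m + 1 + n = m + n + 1 by ring, show 2 * (m + 1) = 2 * m + 1 + 1 by ring]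
    simp only [Nat.factorial_succ] at hC ⊢
    push_cast at hB hC ⊢
    linear_combination (4 * (n + 1) * (m + n + 1) * (m + 1) : ℤ) * hB - (m + 1 : ℤ) * hC

theorem choose_mul_choose_mul_factorial_sq (m n k : ℕ) :
    (2 * m).choose (m + k) * (2 * n).choose (n + k) * ((m + n)! * (m + n)!)
      = (2 * m)! * (2 * n)! * ((m + n).choose (m + k) * (m + n).choose (n + k)) := by
  rcases Nat.lt_or_ge m k with h | h
  · rw [Nat.choose_eq_zero_of_lt (show 2 * m < m + k by omega),
      Nat.choose_eq_zero_of_lt (show m + n < n + k by omega)]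
    simp
  rcases Nat.lt_or_ge n k with h' | h'
  · rw [Nat.choose_eq_zero_of_lt (show 2 * n < n + k by omega),
      Nat.choose_eq_zero_of_lt (show m + n < m + k by omega)]
    simp
  have h1 := Nat.choose_mul_factorial_mul_factorial (show m + k ≤ 2 * m by omega)
  have h2 := Nat.choose_mul_factorial_mul_factorial (show n + k ≤ 2 * n by omega)
  have h3 := Nat.choose_mul_factorial_mul_factorial (show m + k ≤ m + n by omega)
  have h4 := Nat.choose_mul_factorial_mul_factorial (show n + k ≤ m + n by omega)
  rw [show 2 * m - (m + k) = m - k by omega] at h1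
  rw [show 2 * n - (n + k) = n - k by omega] at h2
  rw [show m + n - (m + k) = n - k by omega] at h3
  rw [show m + n - (n + k) = m - k by omega] at h4
  rw [← h1, ← h2]
  nth_rewrite 1 [← h3]
  rw [← h4]
  ring

theorem corollary6p5 (m n r s a : ℕ) (hm : 0 < m) (hn : 0 < n) (hr : 0 < r) (hs : 0 < s) :
    ∃ d : ℕ,
      (d : ℚ) = ((2 * m)! * (2 * n)! : ℚ) /
        (2 * (m + n)! * (m - 1)! * (n - 1)! * Nat.gcd m n) ∧
      d ∣ ∑ k ∈ Finset.Icc 1 m,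
        k ^ (2 * a + 1) * Nat.choose (2 * m) (m + k) ^ r * Nat.choose (2 * n) (n + k) ^ s := by
  obtain ⟨B, hB⟩ := exists_two_mul_eq_superCatalan m n hn
  refine ⟨B * Nat.lcm m n, ?_, ?_⟩
  · have hg : 0 < Nat.gcd m n := Nat.gcd_pos_of_pos_left n hm
    rw [eq_div_iff (by positivity)]
    have h1 := Nat.gcd_mul_lcm m n
    rw [← Nat.mul_factorial_pred hm.ne', ← Nat.mul_factorial_pred hn.ne'] at hB
    have h2 : B * Nat.lcm m n * (2 * (m + n)! * (m - 1)! * (n - 1)! * Nat.gcd m n)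
        = (2 * m)! * (2 * n)! := by
      linear_combination hB + 2 * B * ((m + n)! * (m - 1)! * (n - 1)!) * h1
    exact_mod_cast h2
  · obtain ⟨p, rfl⟩ : ∃ p, r = p + 1 := ⟨r - 1, by omega⟩
    obtain ⟨q, rfl⟩ : ∃ q, s = q + 1 := ⟨s - 1, by omega⟩
    -- The cutoff m+n+1 exceeds both m and n; the added terms vanish.
    obtain ⟨t, ht⟩ := lcm_mul_choose_dvd_two_mul_sum a m n p q (m + n + 1)
      (by omega) (by omega)
    have hS : ∑ k ∈ Finset.Icc 1 m,
          k ^ (2 * a + 1) * (2 * m).choose (m + k) ^ (p + 1) * (2 * n).choose (n + k) ^ (q + 1)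
        = ∑ k ∈ Finset.range (m + n + 1),
          k ^ (2 * a + 1) * (2 * m).choose (m + k) ^ (p + 1) *
            (2 * n).choose (n + k) ^ (q + 1) := by
      refine Finset.sum_subset ?_ ?_
      · intro k hk
        simp only [Finset.mem_Icc, Finset.mem_range] at hk ⊢
        omega
      · intro k _ hk
        rw [Finset.mem_Icc] at hk
        rcases Nat.eq_zero_or_pos k with rfl | h
        · simp
        · rw [Nat.choose_eq_zero_of_lt (show 2 * m < m + k by omega)]
          simp
    rw [hS]
    refine ⟨t, ?_⟩
    have hF : (∑ k ∈ Finset.range (m + n + 1), k ^ (2 * a + 1) *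
          (2 * m).choose (m + k) ^ (p + 1) * (2 * n).choose (n + k) ^ (q + 1)) *
            ((m + n)! * (m + n)!)
        = (2 * m)! * (2 * n)! * ∑ k ∈ Finset.range (m + n + 1), k ^ (2 * a + 1) *
          ((2 * m).choose (m + k) ^ p * (2 * n).choose (n + k) ^ q *
            ((m + n).choose (m + k) * (m + n).choose (n + k))) := by
      rw [Finset.sum_mul, Finset.mul_sum]
      refine Finset.sum_congr rfl fun k _ => ?_
      linear_combination k ^ (2 * a + 1) * (2 * m).choose (m + k) ^ p *
        (2 * n).choose (n + k) ^ q * choose_mul_choose_mul_factorial_sq m n k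
    have hc := Nat.add_choose_mul_factorial_mul_factorial m n
    rw [← Nat.choose_symm_add] at hc
    have hpos : 0 < (m + n)! * (m + n)! := by positivity
    apply Nat.eq_of_mul_eq_mul_right hpos
    rw [hF, ← hB]
    nth_rewrite 3 [← hc]
    linear_combination B * ((m + n)! * m ! * n !) * ht
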